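/- A continuum is a (nonempty) compact connected Hausdorff space. A continuum $X$ is called Suslinian if every family of pairwise disjoint non-degenerate subcontinua of $X$ (compact connected subsets with more than one point) is countable. The weight $w(X)$ of a topological space $X$ is the smallest cardinality of a base of its topology. A continuous map $f:X\to Y$ is called monotone if $f^{-1}(y)$ is nonempty and connected for every $y\in Y$. Corollary. Let $X$ be a Suslinian continuum that is not metrizable. Then $w(X)=\aleph_1$, and $X$ is homeomorphic to the limit of an inverse spectrum $\{Z_\alpha,\pi_\alpha^\beta:\alpha\le\beta<\omega_1\}$ of length $\aleph_1$, indexed by the countable ordinals, in which every $Z_\alpha$ is a metrizable Suslinian continuum and every bonding map $\pi_\alpha^\beta:Z_\beta\to Z_\alpha$, $\alpha\le\beta<\omega_1$, is monotone. (The bonding maps satisfy $\pi_\alpha^\alpha=\mathrm{id}$ and $\pi_\alpha^\gamma=\pi_\alpha^\beta\circ\pi_\beta^\gamma$ for $\alpha\le\beta\le\gamma<\omega_1$, and the limit is the subspace of $\prod_{\alpha<\omega_1}Z_\alpha$ consisting of all $(z_\alpha)_{\alpha<\omega_1}$ with $\pi_\alpha^\beta(z_\beta)=z_\alpha$ for all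 $\alpha\le\beta<\omega_1$.) -/

import Mathlib

open Cardinal Ordinal Set

/-- A continuum: a compact connected Hausdorff space (nonempty, by `ConnectedSpace`). -/
structure IsContinuum (X : Type*) [TopologicalSpace X] : Prop where
  t2 : T2Space X
  compact : CompactSpace X
  connected : ConnectedSpace X

/-- `K` is a non-degenerate subcontinuum of the (Hausdorff) space `X`: a compact connected
subset with more than one point. -/
structure IsNondegenerateSubcontinuum {X : Type*} [TopologicalSpace X] (K : Set X) : Prop where
  compact : IsCompact K
  connected : IsConnected K
  nontrivial : K.Nontrivial

/-- A Suslinian continuum: a continuum in which every family of pairwise disjoint non-degenerate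
subcontinua is countable. -/
structure IsSuslinianContinuum (X : Type*) [TopologicalSpace X] : Prop where
  isContinuum : IsContinuum X
  countable_of_disjoint : ∀ C : Set (Set X), (∀ K ∈ C, IsNondegenerateSubcontinuum K) →
    C.PairwiseDisjoint id → C.Countable

/-- The weight of a topological space: the least cardinality of a base of its topology. -/
noncomputable def topologicalWeight (X : Type*) [TopologicalSpace X] : Cardinal :=
  sInf {c | ∃ B : Set (Set X), TopologicalSpace.IsTopologicalBasis B ∧ #B = c}

/-- A monotone map: a continuous map all of whose fibers are (nonempty and) connected. -/
structure IsMonotoneMap {X Y : Type*} [TopologicalSpace X] [TopologicalSpace Y] (f : X → Y) :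
    Prop where
  continuous : Continuous f
  isConnected_fiber : ∀ y, IsConnected (f ⁻¹' {y})

universe u v

/-- An inverse spectrum of topological spaces over a preordered index set, with continuous bonding
maps `bond : space β → space α` for `α ≤ β`. -/
structure InverseSpectrum (ι : Type v) [Preorder ι] where
  space : ι → Type u
  top : ∀ α, TopologicalSpace (space α)
  bond : ∀ {α β : ι}, α ≤ β → space β → space α
  continuous_bond : ∀ {α β : ι} (h : α ≤ β), Continuous (bond h)
  bond_self : ∀ (α : ι) (x : space α), bond (le_refl α) x = x
  bond_bond : ∀ {α β γ : ι} (h : α ≤ β) (h' : β ≤ γ) (x : space γ),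
    bond h (bond h' x) = bond (h.trans h') x

attribute [instance] InverseSpectrum.top

/-- The limit of an inverse spectrum: the space of threads, a subspace of the product. -/
def InverseSpectrum.Limit {ι : Type v} [Preorder ι] (S : InverseSpectrum.{u, v} ι) :
    Type (max u v) :=
  {x : ∀ α, S.space α // ∀ (α β : ι) (h : α ≤ β), S.bond h (x β) = x α}

instance InverseSpectrum.instTopologicalSpaceLimit {ι : Type v} [Preorder ι]
    (S : InverseSpectrum.{u, v} ι) : TopologicalSpace S.Limit :=
  inferInstanceAs (TopologicalSpace
    {x : ∀ α, S.space α // ∀ (α β : ι) (h : α ≤ β), S.bond h (x β) = x α})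

open Topology

section BoundaryBumping

variable {X : Type*} [TopologicalSpace X]

/-- In a compact Hausdorff space, a component contained in an open set `O` has a clopen
neighbourhood of its base point contained in `O`. -/
theorem exists_isClopen_of_connectedComponent_subset [T2Space X] [CompactSpace X] {x : X}
    {O : Set X} (hO : IsOpen O) (hx : connectedComponent x ⊆ O) :
    ∃ V : Set X, IsClopen V ∧ x ∈ V ∧ V ⊆ O := by
  have : Nonempty { s : Set X // IsClopen s ∧ x ∈ s } := ⟨⟨univ, isClopen_univ, mem_univ x⟩⟩
  rw [connectedComponent_eq_iInter_isClopen] at hx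
  obtain ⟨V, hV⟩ := exists_subset_nhds_of_compactSpace
    (V := fun s : { s : Set X // IsClopen s ∧ x ∈ s } => s.1)
    (fun s t => ⟨⟨s.1 ∩ t.1, s.2.1.inter t.2.1, s.2.2, t.2.2⟩, inter_subset_left,
      inter_subset_right⟩) (fun s => s.2.1.1) (fun y hy => hO.mem_nhds (hx hy))
  exact ⟨V.1, V.2.1, V.2.2, hV⟩

theorem IsCompact.connectedComponentIn [T2Space X] {F : Set X} (hF : IsCompact F) (x : X) :
    IsCompact (connectedComponentIn F x) := by
  by_cases hx : x ∈ F
  · rw [connectedComponentIn_eq_image hx]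
    have := isCompact_iff_compactSpace.mp hF
    exact isClosed_connectedComponent.isCompact.image continuous_subtype_val
  · rw [connectedComponentIn_eq_empty hx]
    exact isCompact_empty

/-- Boundary bumping: in a non-degenerate continuum, the component of a closed set at an interior
point is non-degenerate. -/
theorem isNondegenerateSubcontinuum_connectedComponentIn [T2Space X] [CompactSpace X]
    [ConnectedSpace X] [Nontrivial X] {F : Set X} (hF : IsClosed F) {x : X}
    (hx : x ∈ interior F) : IsNondegenerateSubcontinuum (connectedComponentIn F x) := by
  have hxF := interior_subset hx
  refine ⟨hF.isCompact.connectedComponentIn x, isConnected_connectedComponentIn_iff.2 hxF, ?_⟩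
  by_contra hsub
  rw [not_nontrivial_iff] at hsub
  obtain ⟨z, hz⟩ := exists_ne x
  have : CompactSpace F := isCompact_iff_compactSpace.mp hF.isCompact
  rw [connectedComponentIn_eq_image hxF] at hsub
  obtain ⟨V, hV, hxV, hVO⟩ := exists_isClopen_of_connectedComponent_subset (x := ⟨x, hxF⟩)
    (O := Subtype.val ⁻¹' (interior F \ {z}))
    ((isOpen_interior.sdiff isClosed_singleton).preimage continuous_subtype_val) (by
      intro y hy
      have : y.1 = x := hsub ⟨y, hy, rfl⟩ ⟨_, mem_connectedComponent, rfl⟩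
      simp only [mem_preimage, this]
      exact ⟨hx, hz.symm⟩)
  have hclopen : IsClopen (Subtype.val '' V) := by
    refine ⟨(hV.1.isCompact.image continuous_subtype_val).isClosed, ?_⟩
    obtain ⟨G, hG, rfl⟩ := isOpen_induced_iff.1 hV.2
    convert hG.inter isOpen_interior using 1
    ext y
    constructor
    · rintro ⟨w, hw, rfl⟩
      exact ⟨hw, (hVO hw).1⟩
    · rintro ⟨h1, h2⟩
      exact ⟨⟨y, interior_subset h2⟩, h1, rfl⟩
  have huniv := hclopen.eq_univ ⟨x, _, hxV, rfl⟩
  obtain ⟨w, hw, hwz⟩ := huniv.ge (mem_univ z)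
  exact (hVO hw).2 hwz

/-- A continuum contains a non-degenerate subcontinuum missing a given nonempty proper closed
subset. -/
theorem exists_isNondegenerateSubcontinuum_subset_diff [T2Space X] {K L : Set X}
    (hK : IsCompact K) (hKc : IsConnected K) (hL : IsClosed L) (hLne : (L ∩ K).Nonempty)
    (hKL : ¬ K ⊆ L) : ∃ M, IsNondegenerateSubcontinuum M ∧ M ⊆ K \ L := by
  obtain ⟨p, hpK, hpL⟩ := not_subset.1 hKL
  obtain ⟨q, hqL, hqK⟩ := hLne
  have : CompactSpace K := isCompact_iff_compactSpace.mp hK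
  have : ConnectedSpace K := isConnected_iff_connectedSpace.mp hKc
  have : Nontrivial K := ⟨⟨p, hpK⟩, ⟨q, hqK⟩, fun h => hpL (by
    have := congrArg Subtype.val h
    simp only at this
    rwa [this])⟩
  have hnhds : (Subtype.val ⁻¹' Lᶜ : Set K) ∈ 𝓝 (⟨p, hpK⟩ : K) :=
    (hL.isOpen_compl.preimage continuous_subtype_val).mem_nhds hpL
  obtain ⟨F, hF, hFc, hFL⟩ := exists_mem_nhds_isClosed_subset hnhds
  have hM := isNondegenerateSubcontinuum_connectedComponentIn hFc (mem_interior_iff_mem_nhds.2 hF)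
  refine ⟨Subtype.val '' connectedComponentIn F ⟨p, hpK⟩,
    ⟨hM.compact.image continuous_subtype_val, hM.connected.image _ continuous_subtype_val.continuousOn,
      hM.nontrivial.image Subtype.val_injective⟩, ?_⟩
  rintro _ ⟨y, hy, rfl⟩
  exact ⟨y.2, hFL (connectedComponentIn_subset _ _ hy)⟩

end BoundaryBumping

section Quotients

variable {X : Type*} [TopologicalSpace X]

/-- Two points are related if some connected set, on which all functions of the family `A` are
constant, contains both. The classes are the components of the fibers of the diagonal map of
`A`. -/
def fiberComponentSetoid (A : Set C(X, ℝ)) : Setoid X where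
  r x y := ∃ C : Set X, IsPreconnected C ∧ x ∈ C ∧ y ∈ C ∧ ∀ g ∈ A, ∀ p ∈ C, ∀ q ∈ C, g p = g q
  iseqv :=
    { refl := fun x => ⟨{x}, isPreconnected_singleton, rfl, rfl, by
        rintro g - p rfl q rfl; rfl⟩
      symm := by
        rintro x y ⟨C, hC, hx, hy, h⟩
        exact ⟨C, hC, hy, hx, h⟩
      trans := by
        rintro x y z ⟨C, hC, hx, hy, h⟩ ⟨D, hD, hy', hz, h'⟩
        refine ⟨C ∪ D, hC.union y hy hy' hD, .inl hx, .inr hz, fun g hg => ?_⟩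
        have key : ∀ p ∈ C ∪ D, g p = g y := by
          rintro p (hp | hp)
          · exact h g hg p hp y hy
          · exact h' g hg p hp y hy'
        exact fun p hp q hq => (key p hp).trans (key q hq).symm }

theorem fiberComponentSetoid_anti {A B : Set C(X, ℝ)} (h : A ⊆ B) {x y : X}
    (hxy : fiberComponentSetoid B x y) : fiberComponentSetoid A x y := by
  obtain ⟨C, hC, hx, hy, hg⟩ := hxy
  exact ⟨C, hC, hx, hy, fun g hgA => hg g (h hgA)⟩

theorem eq_of_fiberComponentSetoid {A : Set C(X, ℝ)} {x y : X} (h : fiberComponentSetoid A x y)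
    {g : C(X, ℝ)} (hg : g ∈ A) : g x = g y := by
  obtain ⟨C, -, hx, hy, h⟩ := h
  exact h g hg x hx y hy

theorem isConnected_fiberComponentSetoid (A : Set C(X, ℝ)) (x : X) :
    IsConnected {y | fiberComponentSetoid A x y} := by
  refine ⟨⟨x, (fiberComponentSetoid A).refl x⟩, ?_⟩
  have : {y | fiberComponentSetoid A x y} = ⋃₀ {C : Set X | IsPreconnected C ∧ x ∈ C ∧
      ∀ g ∈ A, ∀ p ∈ C, ∀ q ∈ C, g p = g q} := by
    ext y
    constructor
    · rintro ⟨C, hC, hx, hy, h⟩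
      exact ⟨C, ⟨hC, hx, h⟩, hy⟩
    · rintro ⟨C, ⟨hC, hx, h⟩, hy⟩
      exact ⟨C, hC, hx, hy, h⟩
  rw [this]
  exact isPreconnected_sUnion x _ (fun C hC => hC.2.1) (fun C hC => hC.1)

/-- The quotient of `X` by the components of the fibers of the diagonal map of `A`. -/
abbrev FiberComponents (A : Set C(X, ℝ)) : Type _ := Quotient (fiberComponentSetoid A)

/-- The projection of `X` onto the space of components of fibers. -/
def FiberComponents.mk (A : Set C(X, ℝ)) (x : X) : FiberComponents A :=
  Quotient.mk (fiberComponentSetoid A) x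

theorem FiberComponents.isQuotientMap_mk (A : Set C(X, ℝ)) :
    IsQuotientMap (FiberComponents.mk A) := isQuotientMap_quotient_mk'

theorem FiberComponents.mk_eq_mk {A : Set C(X, ℝ)} {x y : X} :
    FiberComponents.mk A x = FiberComponents.mk A y ↔ fiberComponentSetoid A x y := Quotient.eq

theorem FiberComponents.isMonotoneMap_mk (A : Set C(X, ℝ)) :
    IsMonotoneMap (FiberComponents.mk A) := by
  refine ⟨(FiberComponents.isQuotientMap_mk A).continuous, fun z => ?_⟩
  obtain ⟨x, rfl⟩ := (FiberComponents.isQuotientMap_mk A).surjective z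
  convert isConnected_fiberComponentSetoid A x using 1
  ext y
  exact FiberComponents.mk_eq_mk.trans ⟨(fiberComponentSetoid A).symm, (fiberComponentSetoid A).symm⟩

/-- The map between spaces of components of fibers induced by an inclusion of families. -/
def FiberComponents.map {A B : Set C(X, ℝ)} (h : A ⊆ B) : FiberComponents B → FiberComponents A :=
  Quotient.map' id fun _ _ => fiberComponentSetoid_anti h

theorem FiberComponents.isMonotoneMap_map {A B : Set C(X, ℝ)} (h : A ⊆ B) :
    IsMonotoneMap (FiberComponents.map h) := by
  refine ⟨(FiberComponents.isQuotientMap_mk B).continuous_iff.2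
    (FiberComponents.isQuotientMap_mk A).continuous, fun z => ?_⟩
  convert ((FiberComponents.isMonotoneMap_mk A).isConnected_fiber z).image _
    (FiberComponents.isQuotientMap_mk B).continuous.continuousOn using 1
  ext w
  obtain ⟨x, rfl⟩ := (FiberComponents.isQuotientMap_mk B).surjective w
  constructor
  · intro hx
    exact ⟨x, hx, rfl⟩
  · rintro ⟨y, hy, hyx⟩
    rw [← hyx]
    exact hy

end Quotients

/-- Monotone Hausdorff images of Suslinian continua are Suslinian continua. -/
theorem IsSuslinianContinuum.of_isMonotoneMap {X Y : Type*} [TopologicalSpace X]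
    [TopologicalSpace Y] [T2Space Y] (hX : IsSuslinianContinuum X) {f : X → Y}
    (hf : IsMonotoneMap f) : IsSuslinianContinuum Y := by
  have := hX.isContinuum.t2
  have := hX.isContinuum.compact
  have := hX.isContinuum.connected
  have hsurj : Function.Surjective f := fun y => (hf.isConnected_fiber y).nonempty
  have : CompactSpace Y := hsurj.compactSpace hf.continuous
  have hq : IsQuotientMap f := .of_surjective_continuous hsurj hf.continuous
  refine ⟨⟨inferInstance, inferInstance, hsurj.connectedSpace hf.continuous⟩, fun C hC hd => ?_⟩
  have hinj : Function.Injective (fun K : Set Y => f ⁻¹' K) := hsurj.preimage_injective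
  refine countable_of_injective_of_countable_image (f := fun K : Set Y => f ⁻¹' K)
    hinj.injOn (hX.countable_of_disjoint _ ?_ ?_)
  · rintro _ ⟨K, hK, rfl⟩
    have hK := hC K hK
    refine ⟨(hK.compact.isClosed.preimage hf.continuous).isCompact,
      hq.isCoinducing.isConnected_preimage_of_isClosed hf.isConnected_fiber hK.compact.isClosed
        hK.connected, ?_⟩
    exact hK.nontrivial.preimage hsurj
  · rintro _ ⟨K, hK, rfl⟩ _ ⟨L, hL, rfl⟩ hKL
    exact (hd hK hL (fun h => hKL (by rw [h]))).preimage f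

/-- Cozero sets: every open set of a metrizable space is the cozero set of a continuous
function. -/
theorem IsOpen.exists_continuous_ne_zero_iff {Y : Type*} [TopologicalSpace Y]
    [TopologicalSpace.MetrizableSpace Y] {W : Set Y} (hW : IsOpen W) :
    ∃ φ : C(Y, ℝ), ∀ y, φ y ≠ 0 ↔ y ∈ W := by
  let := TopologicalSpace.metrizableSpaceMetric Y
  rcases (Wᶜ).eq_empty_or_nonempty with h | h
  · refine ⟨1, fun y => ?_⟩
    have : y ∈ W := by
      rw [compl_empty_iff.1 h]
      trivial
    simp [this]
  · refine ⟨⟨fun y => Metric.infDist y Wᶜ, Metric.continuous_infDist_pt _⟩, fun y => ?_⟩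
    have := hW.isClosed_compl.mem_iff_infDist_zero h (x := y)
    simp only [ContinuousMap.coe_mk, ne_eq, ← this, mem_compl_iff, not_not]

section Separation

variable {X : Type*} [TopologicalSpace X]

/-- Points `x`, `x'` of one fiber of `f` that lie in different components of this fiber are
separated by a clopen partition of the preimage of a neighbourhood of the common value. -/
theorem exists_isOpen_cover_fiber [T2Space X] [CompactSpace X] {Y : Type*} [TopologicalSpace Y]
    [T2Space Y] {f : X → Y} (hf : Continuous f) {x x' : X} (hxx' : f x' = f x)
    (hc : x' ∉ connectedComponentIn (f ⁻¹' {f x}) x) :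
    ∃ O O' : Set X, IsOpen O ∧ IsOpen O' ∧ Disjoint O O' ∧ x ∈ O ∧ x' ∈ O' ∧
      ∃ N ∈ 𝓝 (f x), f ⁻¹' N ⊆ O ∪ O' := by
  set K := f ⁻¹' {f x} with hK
  have hKcl : IsClosed K := isClosed_singleton.preimage hf
  have : CompactSpace K := isCompact_iff_compactSpace.mp hKcl.isCompact
  have hxK : x ∈ K := rfl
  have hx'K : x' ∈ K := hxx'
  rw [connectedComponentIn_eq_image hxK] at hc
  obtain ⟨V, hV, hxV, hVO⟩ := exists_isClopen_of_connectedComponent_subset (x := (⟨x, hxK⟩ : K))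
    (O := {(⟨x', hx'K⟩ : K)}ᶜ) isClosed_singleton.isOpen_compl (by
      rintro y hy rfl
      exact hc ⟨_, hy, rfl⟩)
  have hx'V : (⟨x', hx'K⟩ : K) ∈ Vᶜ := fun h => hVO h rfl
  have h1 : IsCompact (Subtype.val '' V) := hV.1.isCompact.image continuous_subtype_val
  have h2 : IsCompact (Subtype.val '' Vᶜ) :=
    hV.compl.1.isCompact.image continuous_subtype_val
  have hd : Disjoint (Subtype.val '' V) (Subtype.val '' Vᶜ) :=
    (disjoint_image_iff Subtype.val_injective).2 disjoint_compl_right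
  obtain ⟨O, O', hO, hO', hVO, hVO', hOO'⟩ := SeparatedNhds.of_isCompact_isCompact h1 h2 hd
  refine ⟨O, O', hO, hO', hOO', hVO ⟨_, hxV, rfl⟩, hVO' ⟨_, hx'V, rfl⟩, ?_⟩
  refine ⟨(f '' (O ∪ O')ᶜ)ᶜ, ?_, ?_⟩
  · refine (((hO.union hO').isClosed_compl.isCompact.image hf).isClosed.isOpen_compl).mem_nhds ?_
    rintro ⟨y, hy, hyx⟩
    apply hy
    by_cases h : (⟨y, hyx⟩ : K) ∈ V
    · exact .inl (hVO ⟨_, h, rfl⟩)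
    · exact .inr (hVO' ⟨_, h, rfl⟩)
  · intro y hy
    by_contra h
    exact hy ⟨y, h, rfl⟩

open Classical in
/-- If `O` and `O'` are disjoint open sets that cover the preimage of the closure of the cozero
set of `φ`, then `φ ∘ f` may be cut off to `O`. -/
theorem exists_continuous_indicator {Y : Type*} [TopologicalSpace Y] {f : X → Y}
    (hf : Continuous f) {O O' : Set X} (hO : IsOpen O) (hO' : IsOpen O') (hd : Disjoint O O')
    {W : Set Y} (hW : f ⁻¹' closure W ⊆ O ∪ O') {φ : C(Y, ℝ)} (hφ : ∀ y, φ y ≠ 0 ↔ y ∈ W) :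
    ∃ g : C(X, ℝ), ∀ x, g x = if x ∈ O then φ (f x) else 0 := by
  refine ⟨⟨fun x => if x ∈ O then φ (f x) else 0, ?_⟩, fun x => rfl⟩
  refine continuous_iff_continuousAt.2 fun x => ?_
  by_cases hx : f x ∈ closure W
  · rcases hW hx with h | h
    · refine ContinuousAt.congr (f := fun x => φ (f x)) (by fun_prop) ?_
      filter_upwards [hO.mem_nhds h] with y hy
      rw [if_pos hy]
    · refine ContinuousAt.congr (f := fun _ => 0) continuousAt_const ?_
      filter_upwards [hO'.mem_nhds h] with y hy
      rw [if_neg (fun h' => hd.le_bot ⟨h', hy⟩)]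
  · refine ContinuousAt.congr (f := fun _ => 0) continuousAt_const ?_
    filter_upwards [(isClosed_closure.isOpen_compl.preimage hf).mem_nhds hx] with y hy
    have : φ (f y) = 0 := by
      by_contra h
      exact hy (subset_closure ((hφ _).1 h))
    rw [this, ite_self]

/-- In a Suslinian continuum, only countably many components of a closed set meet its interior. -/
theorem IsSuslinianContinuum.countable_components [Nontrivial X] (hX : IsSuslinianContinuum X)
    {F : Set X} (hF : IsClosed F) :
    ((fun x => connectedComponentIn F x) '' interior F).Countable := by
  have := hX.isContinuum.t2
  have := hX.isContinuum.compact
  have := hX.isContinuum.connected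
  refine hX.countable_of_disjoint _ ?_ ?_
  · rintro _ ⟨x, hx, rfl⟩
    exact isNondegenerateSubcontinuum_connectedComponentIn hF hx
  · rintro _ ⟨x, hx, rfl⟩ _ ⟨y, hy, rfl⟩ hxy
    refine Set.disjoint_left.2 fun z hz hz' => hxy ?_
    exact (connectedComponentIn_eq hz).trans (connectedComponentIn_eq hz').symm

/-- For a countable family `A` of functions on a Suslinian continuum there is a countable family
of functions that are constant on the components of the fibers of `A` and that separate these
components. -/
theorem IsSuslinianContinuum.exists_countable_separating [Nontrivial X]
    (hX : IsSuslinianContinuum X) {A : Set C(X, ℝ)} (hA : A.Countable) :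
    ∃ B : Set C(X, ℝ), B.Countable ∧
      ∀ x y, fiberComponentSetoid A x y ↔ ∀ g ∈ B, g x = g y := by
  classical
  have := hX.isContinuum.t2
  have := hX.isContinuum.compact
  have : Countable A := hA
  let f : X → (A → ℝ) := fun x a => a.1 x
  have hf : Continuous f := by fun_prop
  have hfA : ∀ {x y}, f x = f y ↔ ∀ g ∈ A, g x = g y := fun {x y} =>
    ⟨fun h g hg => congrFun h ⟨g, hg⟩, fun h => funext fun a => h a.1 a.2⟩
  let P : Set (A → ℝ) × Set X × Set X → Set C(X, ℝ) := fun t =>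
    {g | (∀ x y, fiberComponentSetoid A x y → g x = g y) ∧
      ∀ x ∈ t.2.1, ∀ y ∈ t.2.2, f x ∈ t.1 → f y ∈ t.1 → g x ≠ g y}
  let T : Set (Set (A → ℝ) × Set X × Set X) :=
    ⋃ W ∈ TopologicalSpace.countableBasis (A → ℝ),
      {W} ×ˢ (((fun x => connectedComponentIn (f ⁻¹' closure W) x) ''
          interior (f ⁻¹' closure W)) ×ˢ
        ((fun x => connectedComponentIn (f ⁻¹' closure W) x) '' interior (f ⁻¹' closure W)))
  have hT : T.Countable := by
    refine (TopologicalSpace.countable_countableBasis _).biUnion fun W _ => ?_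
    have := hX.countable_components (isClosed_closure.preimage hf : IsClosed (f ⁻¹' closure W))
    exact (countable_singleton W).prod (this.prod this)
  let G : Set (A → ℝ) × Set X × Set X → C(X, ℝ) := fun t =>
    if h : (P t).Nonempty then h.some else 0
  have hG : ∀ t x y, fiberComponentSetoid A x y → G t x = G t y := by
    intro t x y hxy
    by_cases h : (P t).Nonempty
    · simp only [G, dif_pos h]
      exact h.some_mem.1 x y hxy
    · simp only [G, dif_neg h]
      rfl
  refine ⟨A ∪ G '' T, hA.union (hT.image G), fun x y => ⟨?_, fun h => ?_⟩⟩
  · rintro h g (hg | ⟨t, -, rfl⟩)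
    · exact eq_of_fiberComponentSetoid h hg
    · exact hG t x y h
  · by_contra hxy
    have hfxy : f y = f x := hfA.2 fun g hg => (h g (.inl hg)).symm
    have hc : y ∉ connectedComponentIn (f ⁻¹' {f x}) x := fun hy =>
      hxy ⟨connectedComponentIn (f ⁻¹' {f x}) x, isPreconnected_connectedComponentIn,
        mem_connectedComponentIn rfl, hy, fun g hg p hp q hq => hfA.1 ((connectedComponentIn_subset _ _ hp :).trans
          (connectedComponentIn_subset _ _ hq :).symm) g hg⟩
    obtain ⟨O, O', hO, hO', hOO', hxO, hyO', N, hN, hNO⟩ := exists_isOpen_cover_fiber hf hfxy hc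
    obtain ⟨N', hN', hN'c, hN'N⟩ := exists_mem_nhds_isClosed_subset hN
    obtain ⟨W, hW, hxW, hWN⟩ := (TopologicalSpace.isBasis_countableBasis (A → ℝ)).mem_nhds_iff.1 hN'
    have hWo := TopologicalSpace.isOpen_of_mem_countableBasis hW
    have hcov : f ⁻¹' closure W ⊆ O ∪ O' :=
      (preimage_mono ((closure_minimal hWN hN'c).trans hN'N)).trans hNO
    obtain ⟨φ, hφ⟩ := hWo.exists_continuous_ne_zero_iff
    obtain ⟨g, hg⟩ := exists_continuous_indicator hf hO hO' hOO' hcov hφ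
    have hsplit : ∀ C : Set X, IsPreconnected C → C ⊆ f ⁻¹' closure W → ∀ p ∈ C, ∀ q ∈ C,
        p ∈ O → q ∈ O := by
      intro C hC hCW p hp q hq hpO
      exact hC.subset_left_of_subset_union hO hO' hOO' (hCW.trans hcov) ⟨p, hp, hpO⟩ hq
    have hint : ∀ z, f z ∈ W → z ∈ interior (f ⁻¹' closure W) := fun z hz =>
      interior_maximal (preimage_mono subset_closure) (hWo.preimage hf) hz
    have hyW : f y ∈ W := hfxy ▸ hxW
    have hcl : ∀ z, f z ∈ W → z ∈ connectedComponentIn (f ⁻¹' closure W) z := fun z hz =>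
      mem_connectedComponentIn (subset_closure hz)
    set t : Set (A → ℝ) × Set X × Set X := (W, connectedComponentIn (f ⁻¹' closure W) x,
      connectedComponentIn (f ⁻¹' closure W) y) with ht
    have htT : t ∈ T := mem_biUnion hW
      ⟨rfl, ⟨x, hint x hxW, rfl⟩, ⟨y, hint y hyW, rfl⟩⟩
    have hgP : g ∈ P t := by
      constructor
      · rintro p q ⟨C, hC, hp, hq, hcon⟩
        have hpq : f p = f q := hfA.2 fun g hg => hcon g hg p hp q hq
        rw [hg, hg, hpq]
        by_cases hqW : f q ∈ W
        · have hCW : C ⊆ f ⁻¹' closure W := fun r hr => by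
            have : f r = f q := hfA.2 fun g hg => hcon g hg r hr q hq
            exact subset_closure (this ▸ hqW)
          simp only [show p ∈ O ↔ q ∈ O from
            ⟨hsplit C hC hCW p hp q hq, hsplit C hC hCW q hq p hp⟩]
        · have : φ (f q) = 0 := by
            by_contra h
            exact hqW ((hφ _).1 h)
          simp only [this, ite_self]
      · intro p hp q hq hpW hqW
        have hpO : p ∈ O := hsplit _ isPreconnected_connectedComponentIn
          (connectedComponentIn_subset _ _) x (hcl x hxW) p hp hxO
        have hqO : q ∉ O := fun hqO => hOO'.le_bot ⟨hsplit _ isPreconnected_connectedComponentIn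
          (connectedComponentIn_subset _ _) q hq y (hcl y hyW) hqO, hyO'⟩
        rw [hg, hg, if_pos hpO, if_neg hqO]
        exact (hφ _).2 hpW
    have hne : (P t).Nonempty := ⟨g, hgP⟩
    have := h (G t) (.inr ⟨t, htT, rfl⟩)
    simp only [G, dif_pos hne] at this
    exact hne.some_mem.2 x (hcl x hxW) y (hcl y hyW) hxW hyW this

/-- The space of components of the fibers of a countable family of functions on a Suslinian
continuum is metrizable. -/
theorem IsSuslinianContinuum.metrizableSpace_fiberComponents [Nontrivial X]
    (hX : IsSuslinianContinuum X) {A : Set C(X, ℝ)} (hA : A.Countable) :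
    TopologicalSpace.MetrizableSpace (FiberComponents A) := by
  have := hX.isContinuum.compact
  obtain ⟨B, hB, hAB⟩ := hX.exists_countable_separating hA
  have : Countable B := hB
  have : CompactSpace (FiberComponents A) := Quotient.compactSpace
  let F : FiberComponents A → (B → ℝ) := fun z b =>
    Quotient.lift (fun x => b.1 x) (fun x y hxy => (hAB x y).1 hxy b.1 b.2) z
  have hF : Continuous F := continuous_pi fun b => Continuous.quotient_lift b.1.continuous _
  have hinj : Function.Injective F := by
    intro z w h
    obtain ⟨x, rfl⟩ := (FiberComponents.isQuotientMap_mk A).surjective z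
    obtain ⟨y, rfl⟩ := (FiberComponents.isQuotientMap_mk A).surjective w
    exact FiberComponents.mk_eq_mk.2 ((hAB x y).2 fun g hg => congrFun h ⟨g, hg⟩)
  exact (hF.isClosedEmbedding hinj).isEmbedding.metrizableSpace

/-- A countable family of functions on a Suslinian continuum may be enlarged to a countable family
that is nonconstant on every non-degenerate component of the fibers of the original family. -/
theorem IsSuslinianContinuum.exists_countable_refinement [Nontrivial X]
    (hX : IsSuslinianContinuum X) {A : Set C(X, ℝ)} (hA : A.Countable) :
    ∃ B : Set C(X, ℝ), B.Countable ∧ A ⊆ B ∧ ∀ x y, fiberComponentSetoid A x y → x ≠ y →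
      ∃ z, fiberComponentSetoid A x z ∧ ¬ fiberComponentSetoid B x z := by
  have := hX.isContinuum.t2
  have := hX.isContinuum.compact
  have := hX.metrizableSpace_fiberComponents hA
  have hmk := FiberComponents.isMonotoneMap_mk A
  let 𝒦 : Set (Set X) := {K | K.Nontrivial ∧ ∃ x, {y | fiberComponentSetoid A x y} = K}
  have h𝒦 : 𝒦.Countable := by
    refine hX.countable_of_disjoint _ ?_ ?_
    · rintro _ ⟨hK, x, rfl⟩
      refine ⟨IsClosed.isCompact ?_, isConnected_fiberComponentSetoid A x, hK⟩
      have : {y | fiberComponentSetoid A x y} =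
          FiberComponents.mk A ⁻¹' {FiberComponents.mk A x} := by
        ext y
        exact FiberComponents.mk_eq_mk.symm.trans eq_comm
      rw [this]
      exact isClosed_singleton.preimage hmk.continuous
    · rintro _ ⟨-, x, rfl⟩ _ ⟨-, y, rfl⟩ hxy
      refine Set.disjoint_left.2 fun z hz hz' => hxy ?_
      have hxy := (fiberComponentSetoid A).trans hz ((fiberComponentSetoid A).symm hz')
      ext w
      exact ⟨(fiberComponentSetoid A).trans ((fiberComponentSetoid A).symm hxy),
        (fiberComponentSetoid A).trans hxy⟩
  have hsep : ∀ K : 𝒦, ∃ g : C(X, ℝ), ∃ p ∈ K.1, ∃ q ∈ K.1, g p ≠ g q := by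
    rintro ⟨K, ⟨p, hp, q, hq, hpq⟩, -⟩
    obtain ⟨φ, h0, h1, -⟩ := exists_continuous_zero_one_of_isClosed
      (isClosed_singleton (x := p)) (isClosed_singleton (x := q)) (disjoint_singleton.2 hpq)
    refine ⟨φ, p, hp, q, hq, ?_⟩
    rw [h0 rfl, h1 rfl]
    exact zero_ne_one
  choose g p hp q hq hpq using hsep
  have : Countable 𝒦 := h𝒦
  refine ⟨A ∪ range g, hA.union (countable_range g), subset_union_left, fun x y hxy hne => ?_⟩
  let K : 𝒦 := ⟨{y | fiberComponentSetoid A x y},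
    ⟨x, (fiberComponentSetoid A).refl x, y, hxy, hne⟩, x, rfl⟩
  by_contra! hall
  have h1 := eq_of_fiberComponentSetoid (hall _ (hp K)) (.inr ⟨K, rfl⟩ : g K ∈ A ∪ range g)
  have h2 := eq_of_fiberComponentSetoid (hall _ (hq K)) (.inr ⟨K, rfl⟩ : g K ∈ A ∪ range g)
  exact hpq K (h1.symm.trans h2)

end Separation

/-- The transfinite iteration of an operation on sets, taking unions at every stage. -/
noncomputable def transfiniteUnion {T : Type*} (E : Set T → Set T) (α : Ordinal.{0}) : Set T :=
  ⋃ β : Iio α, E (transfiniteUnion E β.1)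
termination_by α
decreasing_by exact β.2

section TransfiniteUnion

variable {T : Type*} {E : Set T → Set T}

theorem apply_transfiniteUnion_subset {α β : Ordinal.{0}} (h : α < β) :
    E (transfiniteUnion E α) ⊆ transfiniteUnion E β := by
  rw [transfiniteUnion.eq_1 E β]
  exact subset_iUnion (fun γ : Iio β => E (transfiniteUnion E γ.1)) ⟨α, h⟩

theorem transfiniteUnion_mono : Monotone (transfiniteUnion E) := by
  intro α β h
  rw [transfiniteUnion.eq_1 E α]
  exact iUnion_subset fun γ => apply_transfiniteUnion_subset (γ.2.trans_le h)

theorem countable_Iio_of_lt_omega_one {α : Ordinal.{0}} (h : α < ω₁) : Countable (Iio α) := by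
  rw [← mk_le_aleph0_iff, Cardinal.mk_Iio_ordinal, lift_le_aleph0, ← Order.lt_succ_iff, succ_aleph0]
  exact lt_omega_iff_card_lt.1 h

theorem countable_transfiniteUnion (hE : ∀ A : Set T, A.Countable → (E A).Countable)
    {α : Ordinal.{0}} (h : α < ω₁) : (transfiniteUnion E α).Countable := by
  induction α using WellFoundedLT.induction with
  | ind α ih =>
    rw [transfiniteUnion]
    have := countable_Iio_of_lt_omega_one h
    exact countable_iUnion fun β => hE _ (ih β.1 β.2 (β.2.trans h))

end TransfiniteUnion

theorem mk_Iio_omega_one : #(Iio (ω₁ : Ordinal.{0})) = ℵ₁ := by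
  rw [Cardinal.mk_Iio_ordinal, card_omega, lift_aleph, Ordinal.lift_one]

theorem succ_lt_omega_one {α : Ordinal.{0}} (h : α < ω₁) : Order.succ α < ω₁ :=
  (isSuccLimit_omega 1).succ_lt h

theorem uncountable_Iio_omega_one : ¬ Countable (Iio (ω₁ : Ordinal.{0})) := by
  rw [← mk_le_aleph0_iff, mk_Iio_omega_one, not_le]
  exact aleph0_lt_aleph_one

section Spectrum

variable {X : Type u} [TopologicalSpace X]

/-- An increasing `ω₁`-sequence of countable families of functions, each of which strictly refines
all nontrivial components of the fibers of the preceding ones. -/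
structure IsRefiningSequence (A : Iio (ω₁ : Ordinal.{0}) → Set C(X, ℝ)) : Prop where
  countable : ∀ α, (A α).Countable
  mono : Monotone A
  exists_refine : ∀ α β, α < β → ∀ x y, fiberComponentSetoid (A α) x y → x ≠ y →
      ∃ z, fiberComponentSetoid (A α) x z ∧ ¬ fiberComponentSetoid (A β) x z

theorem IsSuslinianContinuum.exists_isRefiningSequence [Nontrivial X]
    (hX : IsSuslinianContinuum X) :
    ∃ A : Iio (ω₁ : Ordinal.{0}) → Set C(X, ℝ), IsRefiningSequence A := by
  classical
  choose E hEc _ hEr using fun A : {A : Set C(X, ℝ) // A.Countable} =>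
    hX.exists_countable_refinement A.2
  let E' : Set C(X, ℝ) → Set C(X, ℝ) := fun A => if h : A.Countable then E ⟨A, h⟩ else A
  have hE' : ∀ A (h : A.Countable), E' A = E ⟨A, h⟩ := fun A h => dif_pos h
  have hc : ∀ α : Iio (ω₁ : Ordinal.{0}), (transfiniteUnion E' α.1).Countable := fun α =>
    countable_transfiniteUnion (fun A hA => hE' A hA ▸ hEc _) α.2
  refine ⟨fun α => transfiniteUnion E' α.1, hc, fun α β h => transfiniteUnion_mono h,
    fun α β hαβ x y hxy hne => ?_⟩
  obtain ⟨z, hz, hz'⟩ := hEr ⟨_, hc α⟩ x y hxy hne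
  refine ⟨z, hz, fun h => hz' (fiberComponentSetoid_anti ?_ h)⟩
  rw [← hE']
  exact apply_transfiniteUnion_subset hαβ

namespace IsRefiningSequence

variable {A : Iio (ω₁ : Ordinal.{0}) → Set C(X, ℝ)}

theorem isClosed_fiberComponent [Nontrivial X] (hX : IsSuslinianContinuum X)
    (hA : IsRefiningSequence A) (α : Iio (ω₁ : Ordinal.{0})) (x : X) :
    IsClosed {y | fiberComponentSetoid (A α) x y} := by
  have := hX.metrizableSpace_fiberComponents (hA.countable α)
  have h : {y | fiberComponentSetoid (A α) x y} =
      FiberComponents.mk (A α) ⁻¹' {FiberComponents.mk (A α) x} := by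
    ext y
    exact FiberComponents.mk_eq_mk.symm.trans eq_comm
  rw [h]
  exact isClosed_singleton.preimage (FiberComponents.isMonotoneMap_mk _).continuous

/-- The projections onto the members of a refining sequence of quotients separate points. -/
theorem eq_of_forall [Nontrivial X] (hX : IsSuslinianContinuum X) (hA : IsRefiningSequence A)
    {x y : X} (h : ∀ α, fiberComponentSetoid (A α) x y) : x = y := by
  by_contra hne
  have := hX.isContinuum.t2
  have := hX.isContinuum.compact
  let s : Iio (ω₁ : Ordinal.{0}) → Iio (ω₁ : Ordinal.{0}) := fun α =>
    ⟨Order.succ α.1, succ_lt_omega_one α.2⟩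
  have hs : ∀ α, α < s α := fun α => Order.lt_succ α.1
  have hM : ∀ α, ∃ M, IsNondegenerateSubcontinuum M ∧
      M ⊆ {z | fiberComponentSetoid (A α) x z} \ {z | fiberComponentSetoid (A (s α)) x z} := by
    intro α
    refine exists_isNondegenerateSubcontinuum_subset_diff
      (hA.isClosed_fiberComponent hX α x).isCompact (isConnected_fiberComponentSetoid _ x)
      (hA.isClosed_fiberComponent hX (s α) x)
      ⟨x, (fiberComponentSetoid _).refl x, (fiberComponentSetoid _).refl x⟩ fun hsub => ?_
    obtain ⟨z, hz, hz'⟩ := hA.exists_refine α (s α) (hs α) x y (h α) hne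
    exact hz' (hsub hz)
  choose M hM hMsub using hM
  have hlt : ∀ α β, α < β → Disjoint (M α) (M β) := by
    intro α β hαβ
    refine Set.disjoint_left.2 fun z hz hz' => (hMsub α hz).2 ?_
    exact fiberComponentSetoid_anti (hA.mono (show s α ≤ β from
      Order.succ_le_of_lt (Subtype.coe_lt_coe.2 hαβ)))
      (hMsub β hz').1
  have hd : Pairwise (Function.onFun Disjoint M) := by
    intro α β hαβ
    rcases lt_or_gt_of_ne hαβ with h | h
    · exact hlt _ _ h
    · exact (hlt _ _ h).symm
  have hcount := hX.countable_of_disjoint (range M) (by rintro _ ⟨α, rfl⟩; exact hM α)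
    hd.range_pairwise
  have hinj : Function.Injective M := by
    intro α β hαβ
    by_contra hne
    have := hd hne
    rw [Function.onFun, hαβ, disjoint_self] at this
    exact (hM β).nontrivial.nonempty.ne_empty this
  have : Countable (range M) := hcount
  exact uncountable_Iio_omega_one
    (Function.Injective.countable (f := fun α => (⟨M α, α, rfl⟩ : range M))
      fun α β hαβ => hinj (congrArg Subtype.val hαβ))

/-- The inverse spectrum of the spaces of components of fibers. -/
def spectrum (hA : IsRefiningSequence A) : InverseSpectrum.{u} (Iio (ω₁ : Ordinal.{0})) where
  space α := FiberComponents (A α)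
  top _ := inferInstance
  bond h := FiberComponents.map (hA.mono h)
  continuous_bond h := (FiberComponents.isMonotoneMap_map (hA.mono h)).continuous
  bond_self _ := Quotient.ind fun _ => rfl
  bond_bond _ _ := Quotient.ind fun _ => rfl

/-- The canonical map of `X` into the limit of the spectrum. -/
def toLimit (hA : IsRefiningSequence A) (x : X) : hA.spectrum.Limit :=
  ⟨fun α => FiberComponents.mk (A α) x, fun _ _ _ => rfl⟩

theorem directed_fiber (hA : IsRefiningSequence A) (z : hA.spectrum.Limit) :
    Directed (· ⊇ ·) fun α => FiberComponents.mk (A α) ⁻¹' {z.1 α} := by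
  have key : ∀ α β, α ≤ β →
      FiberComponents.mk (A β) ⁻¹' {z.1 β} ⊆ FiberComponents.mk (A α) ⁻¹' {z.1 α} := by
    intro α β h x hx
    have hz : FiberComponents.map (hA.mono h) (z.1 β) = z.1 α := z.2 α β h
    have hx : FiberComponents.mk (A β) x = z.1 β := hx
    rw [← hx] at hz
    exact hz
  exact fun α β => ⟨max α β, key _ _ (le_max_left _ _), key _ _ (le_max_right _ _)⟩

theorem isHomeomorph_toLimit [Nontrivial X] (hX : IsSuslinianContinuum X)
    (hA : IsRefiningSequence A) : IsHomeomorph hA.toLimit := by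
  have := hX.isContinuum.compact
  have hT2 : ∀ α, T2Space (hA.spectrum.space α) := fun α => by
    have : TopologicalSpace.MetrizableSpace (hA.spectrum.space α) :=
      hX.metrizableSpace_fiberComponents (hA.countable α)
    infer_instance
  have : T2Space hA.spectrum.Limit := inferInstanceAs (T2Space {x : ∀ α, hA.spectrum.space α //
    ∀ (α β) (h : α ≤ β), hA.spectrum.bond h (x β) = x α})
  have : Nonempty (Iio (ω₁ : Ordinal.{0})) := ⟨⟨0, omega_pos 1⟩⟩
  refine isHomeomorph_iff_continuous_bijective.2 ⟨?_, fun x y hxy => ?_, fun z => ?_⟩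
  · exact Continuous.subtype_mk
      (continuous_pi fun α => (FiberComponents.isMonotoneMap_mk (A α)).continuous) _
  · exact hA.eq_of_forall hX fun α =>
      FiberComponents.mk_eq_mk.1 (congrFun (congrArg Subtype.val hxy) α)
  · have hcl : ∀ α, IsClosed (FiberComponents.mk (A α) ⁻¹' {z.1 α}) := fun α =>
      (isClosed_singleton (X := hA.spectrum.space α)).preimage
        (FiberComponents.isMonotoneMap_mk (A α)).continuous
    obtain ⟨x, hx⟩ := IsCompact.nonempty_iInter_of_directed_nonempty_isCompact_isClosed _
      (hA.directed_fiber z) (fun α => (((FiberComponents.isMonotoneMap_mk (A α)).isConnected_fiber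
        (z.1 α)).nonempty)) (fun α => (hcl α).isCompact) hcl
    exact ⟨x, Subtype.ext (funext fun α => mem_iInter.1 hx α)⟩

/-- The preimages of open sets of the members of the spectrum form a base. -/
theorem exists_preimage_subset [Nontrivial X] (hX : IsSuslinianContinuum X)
    (hA : IsRefiningSequence A) {x : X} {O : Set X} (hO : IsOpen O) (hx : x ∈ O) :
    ∃ α, ∃ U : Set (FiberComponents (A α)), IsOpen U ∧ FiberComponents.mk (A α) x ∈ U ∧
      FiberComponents.mk (A α) ⁻¹' U ⊆ O := by
  have := hX.isContinuum.compact
  have hT2 : ∀ α, TopologicalSpace.MetrizableSpace (FiberComponents (A α)) := fun α =>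
    hX.metrizableSpace_fiberComponents (hA.countable α)
  have : Nonempty (Iio (ω₁ : Ordinal.{0})) := ⟨⟨0, omega_pos 1⟩⟩
  obtain ⟨α, hα⟩ := exists_subset_nhds_of_compactSpace (hA.directed_fiber (hA.toLimit x))
    (fun α => (isClosed_singleton (X := FiberComponents (A α))).preimage
        (FiberComponents.isMonotoneMap_mk (A α)).continuous) (U := O) (by
      intro y hy
      rw [hA.eq_of_forall hX fun α => FiberComponents.mk_eq_mk.1 (mem_iInter.1 hy α)]
      exact hO.mem_nhds hx)
  refine ⟨α, (FiberComponents.mk (A α) '' Oᶜ)ᶜ,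
    ((hO.isClosed_compl.isCompact.image
      (FiberComponents.isMonotoneMap_mk (A α)).continuous).isClosed.isOpen_compl), ?_, ?_⟩
  · rintro ⟨y, hy, hyx⟩
    exact hy (hα hyx)
  · intro y hy
    by_contra h
    exact hy ⟨y, h, rfl⟩

theorem topologicalWeight_le [Nontrivial X] (hX : IsSuslinianContinuum X)
    (hA : IsRefiningSequence A) : topologicalWeight X ≤ ℵ₁ := by
  have := hX.isContinuum.compact
  have hmetr : ∀ α, TopologicalSpace.MetrizableSpace (FiberComponents (A α)) := fun α =>
    hX.metrizableSpace_fiberComponents (hA.countable α)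
  have hcomp : ∀ α, CompactSpace (FiberComponents (A α)) := fun α => Quotient.compactSpace
  have hsc : ∀ α, SecondCountableTopology (FiberComponents (A α)) := fun α => by
    let := TopologicalSpace.metrizableSpaceMetric (FiberComponents (A α))
    infer_instance
  let ℬ : Set (Set X) := ⋃ α, (fun U => FiberComponents.mk (A α) ⁻¹' U) ''
    TopologicalSpace.countableBasis (FiberComponents (A α))
  have hℬ : TopologicalSpace.IsTopologicalBasis ℬ := by
    refine TopologicalSpace.isTopologicalBasis_of_isOpen_of_nhds ?_ fun x O hx hO => ?_
    · rintro V hV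
      obtain ⟨α, U, hU, rfl⟩ := mem_iUnion.1 hV
      exact (TopologicalSpace.isOpen_of_mem_countableBasis hU).preimage
        (FiberComponents.isMonotoneMap_mk (A α)).continuous
    · obtain ⟨α, U, hU, hxU, hUO⟩ := hA.exists_preimage_subset hX hO hx
      obtain ⟨V, hV, hxV, hVU⟩ :=
        (TopologicalSpace.isBasis_countableBasis _).exists_subset_of_mem_open hxU hU
      exact ⟨_, mem_iUnion.2 ⟨α, V, hV, rfl⟩, hxV, (preimage_mono hVU).trans hUO⟩
  refine (csInf_le' ⟨ℬ, hℬ, rfl⟩ : topologicalWeight X ≤ #ℬ).trans ?_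
  rw [← Cardinal.lift_le.{1}]
  refine (mk_iUnion_le_lift _).trans ?_
  rw [mk_Iio_omega_one, lift_aleph, lift_aleph, Ordinal.lift_one, Ordinal.lift_one]
  refine (mul_le_mul_right (ciSup_le' (a := ℵ₀) fun α => ?_) _).trans
    (mul_eq_left (aleph0_le_aleph 1) (aleph0_le_aleph 1) aleph0_ne_zero).le
  rw [lift_le_aleph0, mk_le_aleph0_iff]
  exact ((TopologicalSpace.countable_countableBasis _).image _)

end IsRefiningSequence

end Spectrum

/-- A compact Hausdorff space of countable weight is metrizable. -/
theorem aleph_one_le_topologicalWeight {X : Type*} [TopologicalSpace X] [T2Space X]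
    [CompactSpace X] (h : ¬ TopologicalSpace.MetrizableSpace X) : ℵ₁ ≤ topologicalWeight X := by
  rw [aleph_one_le_iff, ← not_le]
  intro hle
  apply h
  have hne : {c | ∃ B : Set (Set X), TopologicalSpace.IsTopologicalBasis B ∧ #B = c}.Nonempty :=
    ⟨_, _, TopologicalSpace.isTopologicalBasis_opens, rfl⟩
  obtain ⟨B, hB, hc⟩ := csInf_mem hne
  have : SecondCountableTopology X := hB.secondCountableTopology (mk_le_aleph0_iff.1 (hc.trans_le hle))
  infer_instance

theorem mainTheorem8 {X : Type u} [TopologicalSpace X] (hX : IsSuslinianContinuum X)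
    (hmet : ¬ TopologicalSpace.MetrizableSpace X) :
    topologicalWeight X = ℵ₁ ∧
    ∃ S : InverseSpectrum.{u} (Set.Iio (ω₁ : Ordinal.{0})),
      (∀ α, TopologicalSpace.MetrizableSpace (S.space α) ∧ IsSuslinianContinuum (S.space α)) ∧
      (∀ α β (h : α ≤ β), IsMonotoneMap (S.bond h)) ∧
      Nonempty (X ≃ₜ S.Limit) := by
  have := hX.isContinuum.t2
  have := hX.isContinuum.compact
  have : Nontrivial X := by
    by_contra h
    rw [not_nontrivial_iff_subsingleton] at h
    exact hmet inferInstance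
  obtain ⟨A, hA⟩ := hX.exists_isRefiningSequence
  refine ⟨(hA.topologicalWeight_le hX).antisymm (aleph_one_le_topologicalWeight hmet), hA.spectrum,
    fun α => ?_, fun α β h => FiberComponents.isMonotoneMap_map (hA.mono h),
    ⟨(hA.isHomeomorph_toLimit hX).homeomorph⟩⟩
  have hm := hX.metrizableSpace_fiberComponents (hA.countable α)
  exact ⟨hm, hX.of_isMonotoneMap (Y := FiberComponents (A α)) (FiberComponents.isMonotoneMap_mk (A α))⟩
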